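/- Let $X$ be a separable real Banach space with norm $|\cdot|$, and let $(P_t)_{t\ge 0}$ be a Markov semigroup on $X$, i.e. a family of Markov kernels $P_t(x,dz)$ with $P_0=\mathrm{Id}$ and $P_{s+t}=P_sP_t$; write $P_tf(x)=\int f(z)\,P_t(x,dz)$. Suppose that $(P_t)$ satisfies a modified log-Harnack inequality: there are constants $\alpha>0$, $\beta\ge 0$, functions $C=C(|x|,|y|)>0$ and $\tilde C=\tilde C(|x|,|y|)>0$ that are continuous in $|x|$ and in $|y|$, and a function $\delta(t)\ge 0$ with $\lim_{t\to\infty}\delta(t)=0$, such that $$P_t\log f(y)\ \le\ \log P_tf(x)+C\,|x-y|^{\alpha}+\delta(t)\,\tilde C\,|x-y|^{\beta}\,\|D\log f\|_\infty$$ for all $t>0$, all $x,y\in X$ and all bounded (Fréchet) differentiable functions $f\ge 1$ on $X$ with $\|D\log f\|_\infty:=\sup_{z\in X}\|D\log f(z)\|<\infty$. Then $(P_t)$ is asymptotically strong Feller. That is, for every $x\in X$ there are a sequence of times $t_n>0$ and a sequence of continuous pseudo-metrics $d_n$ on $X$, increasing in $n$, with $\lim_{n\to\infty}d_n(y,z)=1$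 for all $y\ne z$ (a totally separating system), such that $$\inf_{U}\ \limsup_{n\to\infty}\ \sup_{y\in U}\ \|P_{t_n}(x,\cdot)-P_{t_n}(y,\cdot)\|_{d_n}=0,$$ where $U$ runs over the neighbourhoods of $x$ and $\|\mu-\nu\|_d=\inf_\pi\int_{X\times X}d(u,v)\,\pi(du,dv)$, the infimum being over all measures $\pi$ on $X\times X$ with marginals $\mu$ and $\nu$. -/

import Mathlib

open MeasureTheory ProbabilityTheory Filter Topology
open scoped NNReal ENNReal

/-- A Markov semigroup `(P_t)_{t ≥ 0}` on `X`, given by its transition probabilities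
`P_t(x, ·)`: Markov kernels with `P_0 = id` and the Chapman-Kolmogorov equation. -/
structure MarkovSemigroup (X : Type*) [MeasurableSpace X] where
  kernel : ℝ≥0 → Kernel X X
  isMarkov : ∀ t, IsMarkovKernel (kernel t)
  kernel_zero : kernel 0 = Kernel.id
  kernel_add : ∀ s t, kernel (s + t) = kernel t ∘ₖ kernel s

/-- The action on functions, `P_t f (x) = ∫ f(z) P_t(x, dz)`. -/
noncomputable def MarkovSemigroup.op {X : Type*} [MeasurableSpace X]
    (P : MarkovSemigroup X) (t : ℝ≥0) (f : X → ℝ) (x : X) : ℝ :=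
  ∫ z, f z ∂(P.kernel t x)

/-- The supremum norm `‖Dg‖_∞ = sup_z ‖Dg(z)‖` of the Fréchet derivative; it is only used
where this supremum is finite. -/
noncomputable def derivSupNorm {X : Type*} [NormedAddCommGroup X] [NormedSpace ℝ X]
    (g : X → ℝ) : ℝ :=
  ⨆ z, ‖fderiv ℝ g z‖

/-- The modified log-Harnack inequality. The constants `C` and `C'` are positive functions of
`(|x|, |y|)`, continuous in each of the two variables. For a function `f` with
`‖D log f‖_∞ = ∞` nothing is required. -/
def ModifiedLogHarnack {X : Type*} [NormedAddCommGroup X] [NormedSpace ℝ X]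
    [MeasurableSpace X] (P : MarkovSemigroup X) : Prop :=
  ∃ (α β : ℝ) (C C' : ℝ≥0 → ℝ≥0 → ℝ) (δ : ℝ≥0 → ℝ),
    0 < α ∧ 0 ≤ β ∧
    (∀ a b, 0 < C a b) ∧ (∀ a, Continuous fun b => C a b) ∧ (∀ b, Continuous fun a => C a b) ∧
    (∀ a b, 0 < C' a b) ∧ (∀ a, Continuous fun b => C' a b) ∧ (∀ b, Continuous fun a => C' a b) ∧
    (∀ t, 0 ≤ δ t) ∧ Tendsto δ atTop (𝓝 0) ∧
    ∀ t : ℝ≥0, 0 < t → ∀ f : X → ℝ, Differentiable ℝ f → (∀ z, 1 ≤ f z) →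
      (∃ M : ℝ, ∀ z, f z ≤ M) →
      BddAbove (Set.range fun z => ‖fderiv ℝ (fun w => Real.log (f w)) z‖) →
      ∀ x y : X,
        P.op t (fun z => Real.log (f z)) y ≤
          Real.log (P.op t f x) + C ‖x‖₊ ‖y‖₊ * ‖x - y‖ ^ α +
            δ t * C' ‖x‖₊ ‖y‖₊ * ‖x - y‖ ^ β * derivSupNorm (fun z => Real.log (f z))

/-- The set of couplings of `μ` and `ν`: measures on `X × X` with marginals `μ` and `ν`. -/
def couplings {X : Type*} [MeasurableSpace X] (μ ν : Measure X) : Set (Measure (X × X)) :=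
  {π | π.map Prod.fst = μ ∧ π.map Prod.snd = ν}

/-- The transportation distance `‖μ - ν‖_d`, the infimum of `∫ d(x, y) π(dx, dy)` over all
couplings `π` of `μ` and `ν`. -/
noncomputable def transportDist {X : Type*} [MeasurableSpace X] (d : PseudoMetric X ℝ)
    (μ ν : Measure X) : ℝ≥0∞ :=
  ⨅ π ∈ couplings μ ν, ∫⁻ p, ENNReal.ofReal (d p.1 p.2) ∂π

/-- A totally separating system: an increasing sequence of continuous pseudo-metrics
with `d_n(x, y) → 1` whenever `x ≠ y`. -/
structure IsTotallySeparating {X : Type*} [TopologicalSpace X]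
    (d : ℕ → PseudoMetric X ℝ) : Prop where
  continuous : ∀ n, Continuous fun p : X × X => d n p.1 p.2
  monotone : ∀ x y, Monotone fun n => d n x y
  tendsto_one : ∀ x y, x ≠ y → Tendsto (fun n => d n x y) atTop (𝓝 1)

/-- The asymptotic strong Feller property at the point `x`. -/
def AsymptoticallyStrongFellerAt {X : Type*} [TopologicalSpace X] [MeasurableSpace X]
    (P : MarkovSemigroup X) (x : X) : Prop :=
  ∃ (d : ℕ → PseudoMetric X ℝ) (t : ℕ → ℝ≥0),
    IsTotallySeparating d ∧ (∀ n, 0 < t n) ∧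
    (⨅ U ∈ 𝓝 x, limsup (fun n => ⨆ y ∈ U,
      transportDist (d n) (P.kernel (t n) x) (P.kernel (t n) y)) atTop) = 0

/-- The asymptotic strong Feller property. -/
def AsymptoticallyStrongFeller {X : Type*} [TopologicalSpace X] [MeasurableSpace X]
    (P : MarkovSemigroup X) : Prop :=
  ∀ x, AsymptoticallyStrongFellerAt P x

/-! For `0 ≤ g ≤ 1` and small `a > 0`, insert `f = exp (a g)` into the Harnack inequality. Since
`log P_t f ≤ a P_t g + a ^ 2`, division by `a` bounds the oscillation of `P_t g` between two points
by `a + A / a + B ‖Dg‖` (`op_sub_op_le`), where `A = C |x - y| ^ α` is small near `x` and `B`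
carries the factor `δ(t)`. A large `t` therefore makes the bound small uniformly over all `g` with a
prescribed derivative bound.

Transport distance is reached without Kantorovich duality. The pseudo-metric `d_n` depends on
finitely many smooth coordinates in `[0, 1]`, so a finite smooth partition of unity has pieces of
small `d_n`-diameter. Mass common to corresponding pieces moves within a piece at small cost; the
excess is the difference of the integrals of one partial sum of the partition
(`transportDist_le_of_partition`). These finitely many test functions share a derivative bound `L
n`, and `t n` is chosen after it. -/

/-! ### Couplings built from finite decompositions -/

section Coupling

variable {X : Type*} [MeasurableSpace X]

/-- The normalisation of a finite measure (the zero measure if the total mass vanishes). -/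
noncomputable def normalized (μ : Measure X) : Measure X := (μ Set.univ)⁻¹ • μ

lemma smul_normalized (μ : Measure X) [IsFiniteMeasure μ] :
    μ Set.univ • normalized μ = μ := by
  unfold normalized
  by_cases h : μ Set.univ = 0
  · rw [Measure.measure_univ_eq_zero] at h
    simp [h]
  · rw [smul_smul, ENNReal.mul_inv_cancel h (measure_ne_top _ _), one_smul]

lemma mul_normalized_univ (μ : Measure X) [IsFiniteMeasure μ] {c : ℝ≥0∞}
    (hc : c ≤ μ Set.univ) : c * normalized μ Set.univ = c := by
  unfold normalized
  by_cases h : μ Set.univ = 0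
  · simp [h] at hc
    simp [hc]
  · simp [ENNReal.inv_mul_cancel h (measure_ne_top _ _)]

lemma normalized_absolutelyContinuous (μ : Measure X) : normalized μ ≪ μ :=
  Measure.smul_absolutelyContinuous

instance (μ : Measure X) [IsFiniteMeasure μ] : IsFiniteMeasure (normalized μ) := by
  unfold normalized
  by_cases h : μ Set.univ = 0
  · rw [Measure.measure_univ_eq_zero] at h
    simp only [h, smul_zero]
    infer_instance
  · exact Measure.smul_finite _ (by simpa using h)

variable {ι : Type*} [Fintype ι]

/-- If two probability measures are split into finitely many pieces, such that corresponding
pieces are `ε`-close in the pseudo-metric `d ≤ 1`, then their transportation distance is at most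
`ε` plus the total excess mass of the pieces of the first one. -/
lemma transportDist_sum_le (d : PseudoMetric X ℝ) (μ ν : ι → Measure X)
    [∀ i, IsFiniteMeasure (μ i)] [∀ i, IsFiniteMeasure (ν i)]
    (hμ : ∑ i, μ i Set.univ = 1) (hν : ∑ i, ν i Set.univ = 1) (ε : ℝ≥0∞)
    (hd : ∀ x y, d x y ≤ 1)
    (hε : ∀ i, ∀ᵐ p ∂((μ i).prod (ν i)), ENNReal.ofReal (d p.1 p.2) ≤ ε) :
    transportDist d (∑ i, μ i) (∑ i, ν i) ≤
      ε + ∑ i, (μ i Set.univ - ν i Set.univ) := by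
  set m : ι → ℝ≥0∞ := fun i => min (μ i Set.univ) (ν i Set.univ) with hm
  have hma : ∀ i, m i ≤ μ i Set.univ := fun i => min_le_left _ _
  have hmb : ∀ i, m i ≤ ν i Set.univ := fun i => min_le_right _ _
  have hmtop : ∑ i, m i ≠ ∞ :=
    ((Finset.sum_le_sum fun i _ => hma i).trans_lt (by simp [hμ])).ne
  set ρ : Measure X := ∑ i, (μ i Set.univ - m i) • normalized (μ i) with hρ
  set σ : Measure X := ∑ i, (ν i Set.univ - m i) • normalized (ν i) with hσ
  set R : ℝ≥0∞ := ∑ i, (μ i Set.univ - m i) with hR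
  have hρu : ρ Set.univ = R := by
    simp only [hρ, Measure.finsetSum_apply, Measure.smul_apply, smul_eq_mul]
    exact Finset.sum_congr rfl fun i _ => mul_normalized_univ _ tsub_le_self
  have hσu : σ Set.univ = R := by
    have h1 : σ Set.univ = ∑ i, (ν i Set.univ - m i) := by
      simp only [hσ, Measure.finsetSum_apply, Measure.smul_apply, smul_eq_mul]
      exact Finset.sum_congr rfl fun i _ => mul_normalized_univ _ tsub_le_self
    rw [h1, hR, ← ENNReal.add_left_inj hmtop, ← Finset.sum_add_distrib, ← Finset.sum_add_distrib]
    simp only [tsub_add_cancel_of_le (hma _), tsub_add_cancel_of_le (hmb _), hμ, hν]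
  have hRtop : R ≠ ∞ :=
    ((Finset.sum_le_sum fun i _ => tsub_le_self).trans_lt (by simp [hμ])).ne
  have : IsFiniteMeasure ρ := ⟨by rw [hρu]; exact hRtop.lt_top⟩
  have : IsFiniteMeasure σ := ⟨by rw [hσu]; exact hRtop.lt_top⟩
  -- If `R = 0` then `R⁻¹ * R = 0`, but the leftover measures vanish as well.
  have hcancel : ∀ τ : Measure X, τ Set.univ = R → (R⁻¹ * R) • τ = τ := by
    intro τ hτ
    by_cases h : R = 0
    · rw [h, Measure.measure_univ_eq_zero] at hτ
      simp [hτ]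
    · rw [ENNReal.inv_mul_cancel h hRtop, one_smul]
  -- The common mass `m i` stays inside piece `i`; the leftovers `ρ` and `σ` have equal mass `R` and
  -- are coupled independently, at cost at most `R` because `d ≤ 1`.
  set π : Measure (X × X) :=
    ∑ i, m i • (normalized (μ i)).prod (normalized (ν i)) + R⁻¹ • ρ.prod σ with hπ
  have hfst : π.map Prod.fst = ∑ i, μ i := by
    rw [hπ, Measure.map_add _ _ measurable_fst, Measure.map_finset_sum measurable_fst.aemeasurable,
      Measure.map_smul, Measure.map_fst_prod, hσu, smul_smul, hcancel ρ hρu, hρ,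
      ← Finset.sum_add_distrib]
    refine Finset.sum_congr rfl fun i _ => ?_
    rw [Measure.map_smul, Measure.map_fst_prod, smul_smul, mul_normalized_univ _ (hmb i),
      ← add_smul, add_tsub_cancel_of_le (hma i), smul_normalized]
  have hsnd : π.map Prod.snd = ∑ i, ν i := by
    rw [hπ, Measure.map_add _ _ measurable_snd, Measure.map_finset_sum measurable_snd.aemeasurable,
      Measure.map_smul, Measure.map_snd_prod, hρu, smul_smul, hcancel σ hσu, hσ,
      ← Finset.sum_add_distrib]
    refine Finset.sum_congr rfl fun i _ => ?_
    rw [Measure.map_smul, Measure.map_snd_prod, smul_smul, mul_normalized_univ _ (hma i),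
      ← add_smul, add_tsub_cancel_of_le (hmb i), smul_normalized]
  refine (iInf₂_le π ⟨hfst, hsnd⟩).trans ?_
  rw [hπ, lintegral_add_measure, lintegral_finsetSum_measure]
  refine add_le_add ?_ ?_
  · calc ∑ i, ∫⁻ p, ENNReal.ofReal (d p.1 p.2)
          ∂(m i • (normalized (μ i)).prod (normalized (ν i)))
        ≤ ∑ i, m i * ε := by
          refine Finset.sum_le_sum fun i _ => ?_
          rw [lintegral_smul_measure, smul_eq_mul]
          have hac : (normalized (μ i)).prod (normalized (ν i)) ≪ (μ i).prod (ν i) :=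
            (normalized_absolutelyContinuous _).prod (normalized_absolutelyContinuous _)
          calc m i * ∫⁻ p, ENNReal.ofReal (d p.1 p.2)
                ∂((normalized (μ i)).prod (normalized (ν i)))
              ≤ m i * ∫⁻ _, ε ∂((normalized (μ i)).prod (normalized (ν i))) := by
                gcongr 1
                exact lintegral_mono_ae (hac.ae_le (hε i))
            _ = m i * ε := by
                rw [lintegral_const, ← Set.univ_prod_univ, Measure.prod_prod,
                  show m i * (ε * (normalized (μ i) Set.univ * normalized (ν i) Set.univ)) =
                    m i * normalized (μ i) Set.univ * normalized (ν i) Set.univ * ε by ring,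
                  mul_normalized_univ _ (hma i), mul_normalized_univ _ (hmb i)]
      _ ≤ 1 * ε := by
          rw [← Finset.sum_mul]
          gcongr
          exact (Finset.sum_le_sum fun i _ => hma i).trans_eq hμ
      _ = ε := one_mul _
  · rw [lintegral_smul_measure, smul_eq_mul]
    calc R⁻¹ * ∫⁻ p, ENNReal.ofReal (d p.1 p.2) ∂(ρ.prod σ)
        ≤ R⁻¹ * ∫⁻ _, 1 ∂(ρ.prod σ) := by
          gcongr with p
          simpa using hd p.1 p.2
      _ = (R⁻¹ * R) * R := by
          rw [lintegral_const, ← Set.univ_prod_univ, Measure.prod_prod, hρu, hσu, one_mul,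
            mul_assoc]
      _ ≤ 1 * R := by
          gcongr
          exact ENNReal.inv_mul_le_one R
      _ = ∑ i, (μ i Set.univ - ν i Set.univ) := by
          simp only [one_mul, hR, hm, tsub_min]

/-- The transportation distance of two probability measures in terms of a finite partition of
unity whose members have small support in the pseudo-metric `d ≤ 1`: it suffices to compare the
integrals of the partial sums of the partition. -/
lemma transportDist_le_of_partition (d : PseudoMetric X ℝ) (μ ν : Measure X)
    [IsProbabilityMeasure μ] [IsProbabilityMeasure ν] (φ : ι → X → ℝ)
    (hφm : ∀ i, Measurable (φ i)) (hφ0 : ∀ i x, 0 ≤ φ i x) (hφ1 : ∀ x, ∑ i, φ i x = 1)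
    (hd : ∀ x y, d x y ≤ 1) (ε r : ℝ)
    (hε : ∀ i x y, φ i x ≠ 0 → φ i y ≠ 0 → d x y ≤ ε)
    (hr : ∀ S : Finset ι, ∫ x, ∑ i ∈ S, φ i x ∂μ - ∫ x, ∑ i ∈ S, φ i x ∂ν ≤ r) :
    transportDist d μ ν ≤ ENNReal.ofReal ε + ENNReal.ofReal r := by
  have hle : ∀ i x, φ i x ≤ 1 := fun i x =>
    (Finset.single_le_sum (fun j _ => hφ0 j x) (Finset.mem_univ i)).trans_eq (hφ1 x)
  have hint : ∀ (τ : Measure X) [IsProbabilityMeasure τ] i, Integrable (φ i) τ := fun τ _ i =>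
    Integrable.of_bound (hφm i).aestronglyMeasurable 1
      (ae_of_all _ fun x => by rw [Real.norm_of_nonneg (hφ0 i x)]; exact hle i x)
  have hmass : ∀ (τ : Measure X) [IsProbabilityMeasure τ] i,
      τ.withDensity (fun x => ENNReal.ofReal (φ i x)) Set.univ =
        ENNReal.ofReal (∫ x, φ i x ∂τ) := fun τ _ i => by
    rw [withDensity_apply _ MeasurableSet.univ, Measure.restrict_univ,
      ofReal_integral_eq_lintegral_ofReal (hint τ i) (ae_of_all _ (hφ0 i))]
  have hsum : ∀ (τ : Measure X) [IsProbabilityMeasure τ],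
      ∑ i, τ.withDensity (fun x => ENNReal.ofReal (φ i x)) = τ := fun τ _ => by
    ext s hs
    simp only [Measure.finsetSum_apply, withDensity_apply _ hs]
    rw [← lintegral_finsetSum _ fun i _ => (hφm i).ennreal_ofReal]
    simp_rw [← ENNReal.ofReal_sum_of_nonneg fun i _ => hφ0 i _, hφ1]
    simp
  have hfin : ∀ (τ : Measure X) [IsProbabilityMeasure τ] i,
      IsFiniteMeasure (τ.withDensity (fun x => ENNReal.ofReal (φ i x))) := fun τ _ i =>
    ⟨by rw [hmass]; exact ENNReal.ofReal_lt_top⟩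
  have hunit : ∀ (τ : Measure X) [IsProbabilityMeasure τ],
      ∑ i, τ.withDensity (fun x => ENNReal.ofReal (φ i x)) Set.univ = 1 := fun τ _ => by
    rw [← Measure.finsetSum_apply, hsum, measure_univ]
  have hsupp : ∀ (τ : Measure X) i,
      ∀ᵐ x ∂(τ.withDensity (fun x => ENNReal.ofReal (φ i x))), φ i x ≠ 0 := fun τ i => by
    rw [ae_withDensity_iff (hφm i).ennreal_ofReal]
    refine ae_of_all _ fun x hx h => ?_
    simp [h] at hx
  have := hfin μ
  have := hfin ν
  have key := transportDist_sum_le d (fun i => μ.withDensity fun x => ENNReal.ofReal (φ i x))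
    (fun i => ν.withDensity fun x => ENNReal.ofReal (φ i x)) (hunit μ) (hunit ν)
    (ENNReal.ofReal ε) hd (fun i => by
      have h1 := (Measure.quasiMeasurePreserving_fst
        (ν := ν.withDensity fun x => ENNReal.ofReal (φ i x))).ae (hsupp μ i)
      have h2 := (Measure.quasiMeasurePreserving_snd
        (μ := μ.withDensity fun x => ENNReal.ofReal (φ i x))).ae (hsupp ν i)
      filter_upwards [h1, h2] with p hp1 hp2
      exact ENNReal.ofReal_le_ofReal (hε i _ _ hp1 hp2))
  rw [hsum μ, hsum ν] at key
  refine key.trans (add_le_add le_rfl ?_)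
  classical
  -- On the pieces where `μ` has at least as much mass as `ν`, the partial sum collects exactly the
  -- positive parts.
  set S : Finset ι := Finset.univ.filter fun i => ∫ x, φ i x ∂ν ≤ ∫ x, φ i x ∂μ with hS
  have hSr := hr S
  rw [integral_finsetSum _ fun i _ => hint μ i, integral_finsetSum _ fun i _ => hint ν i,
    ← Finset.sum_sub_distrib, hS] at hSr
  refine le_trans (le_of_eq ?_) (ENNReal.ofReal_le_ofReal hSr)
  rw [ENNReal.ofReal_sum_of_nonneg fun i hi => sub_nonneg.2 (Finset.mem_filter.1 hi).2,
    Finset.sum_filter]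
  refine Finset.sum_congr rfl fun i _ => ?_
  rw [hmass, hmass, ← ENNReal.ofReal_sub _ (integral_nonneg (hφ0 i))]
  split_ifs with h
  · rfl
  · exact ENNReal.ofReal_of_nonpos (by linarith)

end Coupling

/-! ### From log-Harnack to oscillation bounds -/

section LogHarnack

/-- Integrating `exp (a g)` for `0 ≤ g ≤ 1` and `0 ≤ a ≤ 1`. -/
lemma log_integral_exp_le {X : Type*} [MeasurableSpace X] (μ : Measure X)
    [IsProbabilityMeasure μ] {g : X → ℝ} (hg : Measurable g) (hg0 : ∀ z, 0 ≤ g z)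
    (hg1 : ∀ z, g z ≤ 1) {a : ℝ} (ha0 : 0 ≤ a) (ha1 : a ≤ 1) :
    Real.log (∫ z, Real.exp (a * g z) ∂μ) ≤ a * ∫ z, g z ∂μ + a ^ 2 := by
  have hgi : Integrable g μ := Integrable.of_bound hg.aestronglyMeasurable 1
    (ae_of_all _ fun z => by rw [Real.norm_of_nonneg (hg0 z)]; exact hg1 z)
  have hei : Integrable (fun z => Real.exp (a * g z)) μ :=
    Integrable.of_bound (by fun_prop) (Real.exp 1) (ae_of_all _ fun z => by
      rw [Real.norm_of_nonneg (Real.exp_pos _).le]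
      exact Real.exp_le_exp.2 (mul_le_one₀ ha1 (hg0 z) (hg1 z)))
  have hle : ∫ z, Real.exp (a * g z) ∂μ ≤ ∫ z, (1 + (a * g z + a ^ 2)) ∂μ := by
    refine integral_mono hei (by fun_prop) fun z => ?_
    have h0 : 0 ≤ a * g z := mul_nonneg ha0 (hg0 z)
    have h1 : a * g z ≤ a := mul_le_of_le_one_right ha0 (hg1 z)
    have h2 := Real.abs_exp_sub_one_sub_id_le (x := a * g z) (by rw [abs_le]; constructor <;> linarith)
    have h3 : (a * g z) ^ 2 ≤ a ^ 2 := pow_le_pow_left₀ h0 h1 2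
    have h4 := (abs_le.1 h2).2
    simp only
    linarith
  have heq : ∫ z, (1 + (a * g z + a ^ 2)) ∂μ = 1 + (a * ∫ z, g z ∂μ + a ^ 2) := by
    rw [integral_add (by fun_prop) (by fun_prop), integral_add (by fun_prop) (by fun_prop),
      integral_const_mul]
    simp
  rw [heq] at hle
  have hpos : 0 < ∫ z, Real.exp (a * g z) ∂μ := integral_exp_pos hei
  linarith [Real.log_le_sub_one_of_pos hpos]

/-- A Harnack inequality for the logarithm, applied to `exp (a g)`, bounds the oscillation of the
semigroup on smooth functions with values in `[0, 1]`. -/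
lemma op_sub_op_le {X : Type*} [NormedAddCommGroup X] [NormedSpace ℝ X]
    [MeasurableSpace X] [BorelSpace X] (P : MarkovSemigroup X) {t : ℝ≥0} {x y : X} {A B : ℝ}
    (hB : 0 ≤ B)
    (hH : ∀ f : X → ℝ, Differentiable ℝ f → (∀ z, 1 ≤ f z) → (∃ M : ℝ, ∀ z, f z ≤ M) →
      BddAbove (Set.range fun z => ‖fderiv ℝ (fun w => Real.log (f w)) z‖) →
      P.op t (fun z => Real.log (f z)) y ≤
        Real.log (P.op t f x) + A + B * derivSupNorm (fun z => Real.log (f z)))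
    {g : X → ℝ} (hg : Differentiable ℝ g) (hg0 : ∀ z, 0 ≤ g z) (hg1 : ∀ z, g z ≤ 1)
    {L : ℝ} (hL : ∀ z, ‖fderiv ℝ g z‖ ≤ L) {a : ℝ} (ha0 : 0 < a) (ha1 : a ≤ 1) :
    P.op t g y - P.op t g x ≤ a + A / a + B * L := by
  have hfd : ∀ z, ‖fderiv ℝ (fun w => a * g w) z‖ ≤ a * L := fun z => by
    rw [fderiv_const_mul (hg z), norm_smul, Real.norm_of_nonneg ha0.le]
    exact mul_le_mul_of_nonneg_left (hL z) ha0.le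
  have h := hH (fun z => Real.exp (a * g z)) (by fun_prop)
    (fun z => Real.one_le_exp (mul_nonneg ha0.le (hg0 z)))
    ⟨Real.exp 1, fun z => Real.exp_le_exp.2 (mul_le_one₀ ha1 (hg0 z) (hg1 z))⟩
    (by
      simp only [Real.log_exp]
      exact ⟨a * L, by rintro _ ⟨z, rfl⟩; exact hfd z⟩)
  simp only [Real.log_exp] at h
  have := P.isMarkov t
  have h1 : derivSupNorm (fun z => a * g z) ≤ a * L := ciSup_le hfd
  have h2 := log_integral_exp_le (P.kernel t x) hg.continuous.measurable hg0 hg1 ha0.le ha1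
  have h3 : P.op t (fun z => a * g z) y = a * P.op t g y := integral_const_mul _ _
  have h4 : B * derivSupNorm (fun z => a * g z) ≤ B * (a * L) := mul_le_mul_of_nonneg_left h1 hB
  unfold MarkovSemigroup.op at h h3 ⊢
  rw [h3] at h
  -- The derivative of `a * g` also scales with `a`, so the gradient term survives the division
  -- unchanged.
  refine le_of_mul_le_mul_left ?_ ha0
  have h5 : a * (a + A / a + B * L) = a ^ 2 + A + B * (a * L) := by field_simp
  rw [h5]
  linarith

end LogHarnack

/-! ### Separating coordinates and pseudo-metrics -/

section Separation

variable {X : Type*} [NormedAddCommGroup X] [NormedSpace ℝ X]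

/-- A separable normed space has a sequence of smooth functions with values in `(0, 1)` and
bounded derivatives that separates points. -/
lemma exists_seq_smooth_separating [TopologicalSpace.SeparableSpace X] :
    ∃ u : ℕ → X → ℝ, (∀ k, Differentiable ℝ (u k)) ∧ (∀ k x, ‖fderiv ℝ (u k) x‖ ≤ 1) ∧
      (∀ k x, u k x ∈ Set.Icc (0 : ℝ) 1) ∧ ∀ x y, x ≠ y → ∃ k, u k x ≠ u k y := by
  -- Norming functionals of a dense sequence, made bounded by the sigmoid.
  choose ξ hξ1 hξ using fun k => exists_dual_vector'' ℝ (TopologicalSpace.denseSeq X k)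
  refine ⟨fun k x => Real.sigmoid (ξ k x), fun k => ?_, fun k x => ?_, fun k x =>
    ⟨Real.sigmoid_nonneg _, Real.sigmoid_le_one _⟩, fun x y hxy => ?_⟩
  · exact differentiable_sigmoid.comp (ξ k).differentiable
  · have h := (Real.hasDerivAt_sigmoid (ξ k x)).comp_hasFDerivAt x (ξ k).hasFDerivAt
    have h' : HasFDerivAt (fun x => Real.sigmoid (ξ k x))
      ((Real.sigmoid (ξ k x) * (1 - Real.sigmoid (ξ k x))) • ξ k) x := h
    rw [h'.fderiv, norm_smul]
    have h0 := Real.sigmoid_nonneg (ξ k x)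
    have h1 := Real.sigmoid_le_one (ξ k x)
    rw [Real.norm_of_nonneg (mul_nonneg h0 (by linarith))]
    exact mul_le_one₀ (mul_le_one₀ h1 (by linarith) (by linarith)) (norm_nonneg _) (hξ1 k)
  · have hz : 0 < ‖x - y‖ / 2 := half_pos (norm_pos_iff.2 (sub_ne_zero.2 hxy))
    obtain ⟨k, hk⟩ := (TopologicalSpace.denseRange_denseSeq X).exists_dist_lt (x - y) hz
    refine ⟨k, fun h => ?_⟩
    have h1 : ξ k (x - y) = 0 := by
      rw [map_sub, sub_eq_zero]
      exact Real.sigmoid_injective h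
    set w := TopologicalSpace.denseSeq X k
    rw [dist_eq_norm] at hk
    -- If `ξ k` kills `x - y`, the vector it norms is no longer than its distance to `x - y`, which
    -- contradicts closeness.
    have h2 : ‖w‖ ≤ ‖x - y - w‖ := by
      have h3 : ξ k w = -ξ k (x - y - w) := by rw [map_sub, h1]; ring
      have h4 : ξ k w = ‖w‖ := hξ k
      rw [← h4, h3]
      calc -ξ k (x - y - w) ≤ ‖ξ k (x - y - w)‖ := neg_le_abs _
        _ ≤ 1 * ‖x - y - w‖ := (ξ k).le_of_opNorm_le (hξ1 k) _
        _ = _ := one_mul _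
    have h5 : ‖x - y‖ ≤ ‖x - y - w‖ + ‖w‖ := norm_le_norm_sub_add _ _
    linarith

/-- The pseudo-metric `min 1 (n ∑_{k < n} |u_k(x) - u_k(y)|)`. -/
noncomputable def truncatedPseudoMetric {X : Type*} (u : ℕ → X → ℝ) (n : ℕ) : PseudoMetric X ℝ where
  toFun x y := min 1 (n * ∑ k ∈ Finset.range n, |u k x - u k y|)
  refl' x := by simp
  symm' x y := by simp only [abs_sub_comm]
  triangle' x y z := by
    have h1 : ∑ k ∈ Finset.range n, |u k x - u k z| ≤
        ∑ k ∈ Finset.range n, |u k x - u k y| + ∑ k ∈ Finset.range n, |u k y - u k z| := by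
      rw [← Finset.sum_add_distrib]
      exact Finset.sum_le_sum fun k _ => abs_sub_le _ _ _
    have h2 := mul_le_mul_of_nonneg_left h1 (Nat.cast_nonneg (α := ℝ) n)
    have h3 : 0 ≤ (n : ℝ) * ∑ k ∈ Finset.range n, |u k x - u k y| := by positivity
    have h4 : 0 ≤ (n : ℝ) * ∑ k ∈ Finset.range n, |u k y - u k z| := by positivity
    rcases min_cases 1 ((n : ℝ) * ∑ k ∈ Finset.range n, |u k x - u k y|) with h | h <;>
    rcases min_cases 1 ((n : ℝ) * ∑ k ∈ Finset.range n, |u k y - u k z|) with h' | h' <;>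
    rw [h.1, h'.1, min_le_iff] <;> first | (left; linarith) | (right; linarith)

lemma truncatedPseudoMetric_apply {X : Type*} (u : ℕ → X → ℝ) (n : ℕ) (x y : X) :
    truncatedPseudoMetric u n x y = min 1 (n * ∑ k ∈ Finset.range n, |u k x - u k y|) := rfl

/-- One separating coordinate suffices: the factor `n` eventually pushes its contribution above the
truncation level 1. -/
lemma isTotallySeparating_truncatedPseudoMetric {X : Type*} [TopologicalSpace X] {u : ℕ → X → ℝ}
    (hu : ∀ k, Continuous (u k)) (hsep : ∀ x y, x ≠ y → ∃ k, u k x ≠ u k y) :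
    IsTotallySeparating (truncatedPseudoMetric u) where
  continuous n := by
    simp only [truncatedPseudoMetric_apply]
    fun_prop
  monotone x y m n hmn := by
    simp only [truncatedPseudoMetric_apply]
    gcongr
  tendsto_one x y hxy := by
    obtain ⟨k, hk⟩ := hsep x y hxy
    have hpos : 0 < |u k x - u k y| := abs_pos.2 (sub_ne_zero.2 hk)
    refine tendsto_const_nhds.congr' ?_
    obtain ⟨N, hN⟩ := exists_nat_gt (1 / |u k x - u k y|)
    filter_upwards [eventually_gt_atTop k, eventually_ge_atTop N] with n hn hn'
    rw [truncatedPseudoMetric_apply, eq_comm, min_eq_left_iff]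
    rw [div_lt_iff₀ hpos] at hN
    calc (1 : ℝ) ≤ N * |u k x - u k y| := hN.le
      _ ≤ n * ∑ k ∈ Finset.range n, |u k x - u k y| := by
        gcongr
        exact Finset.single_le_sum (f := fun k => |u k x - u k y|) (fun _ _ => abs_nonneg _)
          (Finset.mem_range.2 hn)

end Separation

/-! ### Smooth grid partitions -/

section PartitionOfUnity

/-- The `j`-th member of a smooth partition of unity on `[0, 1]` with mesh `1 / M`. -/
noncomputable def intervalBump (M j : ℕ) (s : ℝ) : ℝ :=
  Real.smoothTransition (M * s - j + 1) - Real.smoothTransition (M * s - j)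

lemma contDiff_intervalBump (M j : ℕ) : ContDiff ℝ 1 (intervalBump M j) := by
  have h : ContDiff ℝ 1 Real.smoothTransition := Real.smoothTransition.contDiff (n := 1)
  exact (h.comp (by fun_prop)).sub (h.comp (by fun_prop))

lemma intervalBump_nonneg (M j : ℕ) (s : ℝ) : 0 ≤ intervalBump M j s :=
  sub_nonneg.2 (Real.smoothTransition.monotone (by linarith))

/-- The sum telescopes to the transition at `M s + 1 ≥ 1` minus the transition at `M s - M ≤ 0`. -/
lemma sum_intervalBump (M : ℕ) {s : ℝ} (hs : s ∈ Set.Icc (0 : ℝ) 1) :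
    ∑ j : Fin (M + 1), intervalBump M j s = 1 := by
  have h := Finset.sum_range_sub' (fun j : ℕ => Real.smoothTransition (M * s - j + 1)) (M + 1)
  have h0 : 0 ≤ M * s := mul_nonneg (Nat.cast_nonneg _) hs.1
  have h1 : M * s ≤ M := mul_le_of_le_one_right (Nat.cast_nonneg _) hs.2
  rw [Fin.sum_univ_eq_sum_range (fun j => intervalBump M j s) (M + 1)]
  unfold intervalBump
  have h2 : ∀ j : ℕ, (M : ℝ) * s - (j + 1 : ℕ) + 1 = M * s - j := fun j => by push_cast; ring
  simp only [h2] at h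
  rw [h, Real.smoothTransition.one_of_one_le (by simpa using h0),
    Real.smoothTransition.zero_of_nonpos (by linarith), sub_zero]

/-- Bump `j` vanishes unless `j - 1 ≤ M s ≤ j + 1`. -/
lemma abs_sub_le_of_intervalBump_ne_zero {M j : ℕ} (hM : 0 < M) {s r : ℝ}
    (hs : intervalBump M j s ≠ 0) (hr : intervalBump M j r ≠ 0) : |s - r| ≤ 2 / M := by
  have key : ∀ {q : ℝ}, intervalBump M j q ≠ 0 → (j : ℝ) - 1 ≤ M * q ∧ M * q ≤ j + 1 := by
    intro q hq
    by_contra hcon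
    rw [not_and_or, not_le, not_le] at hcon
    apply hq
    unfold intervalBump
    rcases hcon with h | h
    · rw [Real.smoothTransition.zero_of_nonpos (by linarith),
        Real.smoothTransition.zero_of_nonpos (by linarith), sub_zero]
    · rw [Real.smoothTransition.one_of_one_le (by linarith),
        Real.smoothTransition.one_of_one_le (by linarith), sub_self]
  have hM' : (0 : ℝ) < M := Nat.cast_pos.2 hM
  have hs' := key hs
  have hr' := key hr
  rw [abs_le, neg_le, le_div_iff₀ hM', le_div_iff₀ hM']
  constructor <;> linarith

variable {X : Type*} [NormedAddCommGroup X] [NormedSpace ℝ X]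

/-- A `C¹` function of finitely many bounded functions with bounded derivatives has a bounded
derivative. -/
lemma exists_fderiv_comp_le {n : ℕ} {Φ : (Fin n → ℝ) → ℝ} (hΦ : ContDiff ℝ 1 Φ)
    {u : Fin n → X → ℝ} (hu : ∀ k, Differentiable ℝ (u k)) (hu1 : ∀ k x, ‖fderiv ℝ (u k) x‖ ≤ 1)
    (hu01 : ∀ k x, u k x ∈ Set.Icc (0 : ℝ) 1) :
    ∃ L, ∀ x, ‖fderiv ℝ (fun x => Φ fun k => u k x) x‖ ≤ L := by
  -- The coordinates take values in a compact cube, on which the continuous derivative of `Φ` is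
  -- bounded.
  obtain ⟨L, hL⟩ := (isCompact_univ_pi fun _ : Fin n => isCompact_Icc (a := (0 : ℝ)) (b := 1))
    |>.exists_bound_of_continuousOn (hΦ.continuous_fderiv one_ne_zero).continuousOn
  refine ⟨L, fun x => ?_⟩
  have hx := hL (fun k => u k x) fun k _ => hu01 k x
  have hd : HasFDerivAt (fun x k => u k x) (ContinuousLinearMap.pi fun k => fderiv ℝ (u k) x) x :=
    hasFDerivAt_pi.2 fun k => (hu k x).hasFDerivAt
  have hc := ((hΦ.differentiable one_ne_zero) fun k => u k x).hasFDerivAt.comp x hd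
  have hc' : fderiv ℝ (fun x => Φ fun k => u k x) x =
    (fderiv ℝ Φ fun k => u k x).comp (ContinuousLinearMap.pi fun k => fderiv ℝ (u k) x) := hc.fderiv
  have hpi : ‖ContinuousLinearMap.pi fun k => fderiv ℝ (u k) x‖ ≤ 1 :=
    ContinuousLinearMap.opNorm_le_bound _ zero_le_one fun v =>
      (pi_norm_le_iff_of_nonneg (by positivity)).2 fun k =>
        (fderiv ℝ (u k) x).le_of_opNorm_le (hu1 k x) v
  rw [hc']
  calc _ ≤ _ := ContinuousLinearMap.opNorm_comp_le _ _
    _ ≤ L * 1 := mul_le_mul hx hpi (norm_nonneg _) ((norm_nonneg _).trans hx)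
    _ = L := mul_one L

/-- The members of a partition of unity on `X` subordinate to a grid in the variables `u_k`,
`k < n`. -/
noncomputable def gridBump {X : Type*} (u : ℕ → X → ℝ) (n M : ℕ) (i : Fin n → Fin (M + 1)) (x : X) :
    ℝ :=
  ∏ k : Fin n, intervalBump M (i k) (u k x)

lemma gridBump_nonneg {X : Type*} (u : ℕ → X → ℝ) (n M : ℕ) (i : Fin n → Fin (M + 1)) (x : X) :
    0 ≤ gridBump u n M i x :=
  Finset.prod_nonneg fun _ _ => intervalBump_nonneg _ _ _

lemma sum_gridBump {X : Type*} {u : ℕ → X → ℝ} (hu01 : ∀ k x, u k x ∈ Set.Icc (0 : ℝ) 1)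
    (n M : ℕ) (x : X) : ∑ i, gridBump u n M i x = 1 := by
  unfold gridBump
  rw [← Fintype.piFinset_univ, ← Finset.prod_univ_sum
    (fun _ => Finset.univ) (fun (k : Fin n) (j : Fin (M + 1)) => intervalBump M j (u k x))]
  exact Finset.prod_eq_one fun k _ => sum_intervalBump M (hu01 k x)

lemma truncatedPseudoMetric_le_of_gridBump_ne_zero {X : Type*} {u : ℕ → X → ℝ} {n M : ℕ}
    (hM : 0 < M) {i : Fin n → Fin (M + 1)} {x y : X} (hx : gridBump u n M i x ≠ 0)
    (hy : gridBump u n M i y ≠ 0) : truncatedPseudoMetric u n x y ≤ 2 * n ^ 2 / M := by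
  rw [truncatedPseudoMetric_apply]
  refine (min_le_right _ _).trans ?_
  rw [Finset.sum_range]
  have h : ∑ k : Fin n, |u k x - u k y| ≤ ∑ _k : Fin n, (2 / M : ℝ) :=
    Finset.sum_le_sum fun k _ => abs_sub_le_of_intervalBump_ne_zero hM
      (Finset.prod_ne_zero_iff.1 hx k (Finset.mem_univ k))
      (Finset.prod_ne_zero_iff.1 hy k (Finset.mem_univ k))
  refine (mul_le_mul_of_nonneg_left h (Nat.cast_nonneg n)).trans_eq ?_
  simp
  ring

lemma contDiff_prod_intervalBump {n M : ℕ} (i : Fin n → Fin (M + 1)) :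
    ContDiff ℝ 1 fun s : Fin n → ℝ => ∏ k, intervalBump M (i k) (s k) :=
  contDiff_prod fun k _ => (contDiff_intervalBump M (i k)).comp (contDiff_apply ℝ ℝ k)

lemma differentiable_gridBump {u : ℕ → X → ℝ} (hu : ∀ k, Differentiable ℝ (u k)) (n M : ℕ)
    (i : Fin n → Fin (M + 1)) : Differentiable ℝ (gridBump u n M i) :=
  ((contDiff_prod_intervalBump i).differentiable one_ne_zero).comp
    (differentiable_pi.2 fun k : Fin n => hu k)

/-- The bound is uniform in `S`, so that a single time can serve all partial sums. -/
lemma exists_fderiv_sum_gridBump_le {u : ℕ → X → ℝ} (hu : ∀ k, Differentiable ℝ (u k))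
    (hu1 : ∀ k x, ‖fderiv ℝ (u k) x‖ ≤ 1) (hu01 : ∀ k x, u k x ∈ Set.Icc (0 : ℝ) 1) (n M : ℕ) :
    ∃ L, 0 ≤ L ∧ ∀ (S : Finset (Fin n → Fin (M + 1))) x,
      ‖fderiv ℝ (fun x => ∑ i ∈ S, gridBump u n M i x) x‖ ≤ L := by
  have hex : ∀ i : Fin n → Fin (M + 1), ∃ L, ∀ x, ‖fderiv ℝ (gridBump u n M i) x‖ ≤ L := fun i =>
    exists_fderiv_comp_le (contDiff_prod_intervalBump i) (fun k => hu k) (fun k => hu1 k) fun k => hu01 k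
  choose L hL using hex
  have hL0 : ∀ i, 0 ≤ L i := fun i => (norm_nonneg _).trans (hL i 0)
  refine ⟨∑ i, L i, Finset.sum_nonneg fun i _ => hL0 i, fun S x => ?_⟩
  rw [fderiv_fun_sum fun i _ => differentiable_gridBump hu n M i x]
  calc _ ≤ ∑ i ∈ S, L i := norm_sum_le_of_le _ fun i _ => hL i x
    _ ≤ ∑ i, L i := Finset.sum_le_univ_sum_of_nonneg hL0

end PartitionOfUnity

/-! ### Choice of times and neighbourhood -/

theorem theorem1p1 {X : Type*} [NormedAddCommGroup X] [NormedSpace ℝ X] [CompleteSpace X]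
    [TopologicalSpace.SeparableSpace X] [MeasurableSpace X] [BorelSpace X]
    (P : MarkovSemigroup X) (hP : ModifiedLogHarnack P) :
    AsymptoticallyStrongFeller P := by
  obtain ⟨α, β, C, C', δ, hα, hβ, -, -, hCc, hC', -, hC'c, hδ0, hδ, hH⟩ := hP
  intro x
  obtain ⟨u, hu, hu1, hu01, hsep⟩ := exists_seq_smooth_separating (X := X)
  -- This mesh makes the diameter bound `2 n ^ 2 / M n` at most `1 / (n + 1)`.
  set M : ℕ → ℕ := fun n => 2 * n ^ 2 * (n + 1) + 1 with hM
  choose L hL0 hL using fun n => exists_fderiv_sum_gridBump_le hu hu1 hu01 n (M n)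
  have ht : ∀ n : ℕ, ∃ t : ℝ≥0, 0 < t ∧ δ t * L n ≤ 1 / ((n : ℝ) + 1) := fun n => by
    have h1 : Tendsto (fun t => δ t * L n) atTop (𝓝 0) := by simpa using hδ.mul_const (L n)
    have h2 : (0 : ℝ) < 1 / ((n : ℝ) + 1) := by positivity
    obtain ⟨t, h3, h4⟩ := ((eventually_gt_atTop 0).and (h1.eventually_le_const h2)).exists
    exact ⟨t, h3, h4⟩
  choose t ht0 ht using ht
  refine ⟨truncatedPseudoMetric u, t,
    isTotallySeparating_truncatedPseudoMetric (fun k => (hu k).continuous) hsep, ht0, ?_⟩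
  refine le_antisymm (ENNReal.le_of_forall_pos_le_add fun ε hε _ => ?_) zero_le
  rw [zero_add]
  -- The oscillation bound uses `2 a`, and a third `a` absorbs the terms tending to 0 in `n`.
  set a : ℝ := min 1 (ε / 3) with ha
  have hε' : (0 : ℝ) < ε := hε
  have ha0 : 0 < a := lt_min one_pos (by positivity)
  have ha1 : a ≤ 1 := min_le_left _ _
  have ha3 : 3 * a ≤ ε := by linarith [min_le_right 1 ((ε : ℝ) / 3)]
  set K : ℝ := C' ‖x‖₊ ‖x‖₊ + 1 with hK
  have hUC : ∀ᶠ y in 𝓝 x, C ‖y‖₊ ‖x‖₊ * ‖y - x‖ ^ α ≤ a ^ 2 := by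
    have hc : Continuous fun y : X => (C ‖y‖₊ ‖x‖₊ : ℝ) * ‖y - x‖ ^ α :=
      ((hCc ‖x‖₊).comp continuous_nnnorm).mul
        ((continuous_id.sub continuous_const).norm.rpow_const fun _ => Or.inr hα.le)
    refine (hc.tendsto x).eventually_le_const ?_
    simpa [Real.zero_rpow hα.ne'] using pow_pos ha0 2
  -- As `β` may be 0, this factor is only bounded near `x`; its smallness comes from `δ (t n)`.
  have hUC' : ∀ᶠ y in 𝓝 x, C' ‖y‖₊ ‖x‖₊ * ‖y - x‖ ^ β ≤ K := by
    have hc : Continuous fun y : X => C' ‖y‖₊ ‖x‖₊ := (hC'c ‖x‖₊).comp continuous_nnnorm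
    filter_upwards [(hc.tendsto x).eventually_le_const (lt_add_one _),
      Metric.ball_mem_nhds x one_pos] with y hy1 hy2
    rw [mem_ball_iff_norm] at hy2
    calc C' ‖y‖₊ ‖x‖₊ * ‖y - x‖ ^ β ≤ C' ‖y‖₊ ‖x‖₊ * 1 :=
          mul_le_mul_of_nonneg_left (Real.rpow_le_one (norm_nonneg _) hy2.le hβ) (hC' _ _).le
      _ ≤ K := by rw [mul_one]; exact hy1
  have hK0 : 0 < K := add_pos (hC' _ _) one_pos
  refine le_trans (iInf₂_le {y : X | C ‖y‖₊ ‖x‖₊ * ‖y - x‖ ^ α ≤ a ^ 2 ∧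
    C' ‖y‖₊ ‖x‖₊ * ‖y - x‖ ^ β ≤ K} (hUC.and hUC')) ?_
  refine limsup_le_of_le (by isBoundedDefault) ?_
  have hlim : Tendsto (fun n : ℕ => (1 + K) * (1 / ((n : ℝ) + 1))) atTop (𝓝 0) := by
    simpa using tendsto_one_div_add_atTop_nhds_zero_nat.const_mul (1 + K)
  filter_upwards [hlim.eventually_le_const ha0] with n hn
  refine iSup₂_le fun y hy => ?_
  obtain ⟨hy1, hy2⟩ := hy
  have := P.isMarkov (t n)
  have hMpos : 0 < M n := Nat.succ_pos _
  have hn0 : (0 : ℝ) < 1 / ((n : ℝ) + 1) := by positivity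
  have hdiam : ∀ (i : Fin n → Fin (M n + 1)) (z w : X), gridBump u n (M n) i z ≠ 0 →
      gridBump u n (M n) i w ≠ 0 → truncatedPseudoMetric u n z w ≤ 1 / ((n : ℝ) + 1) :=
    fun i z w hz hw => by
      refine (truncatedPseudoMetric_le_of_gridBump_ne_zero hMpos hz hw).trans ?_
      rw [div_le_div_iff₀ (Nat.cast_pos.2 hMpos) (by positivity)]
      simp only [hM]
      push_cast
      linarith
  have hosc : ∀ S : Finset (Fin n → Fin (M n + 1)),
      ∫ z, ∑ i ∈ S, gridBump u n (M n) i z ∂(P.kernel (t n) x) -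
        ∫ z, ∑ i ∈ S, gridBump u n (M n) i z ∂(P.kernel (t n) y) ≤
      2 * a + K * (1 / ((n : ℝ) + 1)) := fun S => by
    -- The roles of `x` and `y` are exchanged: only the excess of `P_t(x, ·)` over `P_t(y, ·)` has
    -- to be bounded.
    have h := op_sub_op_le P (t := t n) (x := y) (y := x)
      (A := C ‖y‖₊ ‖x‖₊ * ‖y - x‖ ^ α) (B := δ (t n) * C' ‖y‖₊ ‖x‖₊ * ‖y - x‖ ^ β)
      (mul_nonneg (mul_nonneg (hδ0 _) (hC' _ _).le) (Real.rpow_nonneg (norm_nonneg _) _))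
      (fun f hf hf1 hfb hfd => hH (t n) (ht0 n) f hf hf1 hfb hfd y x)
      (g := fun z => ∑ i ∈ S, gridBump u n (M n) i z)
      (Differentiable.fun_sum fun i _ => differentiable_gridBump hu n (M n) i)
      (fun z => Finset.sum_nonneg fun i _ => gridBump_nonneg u n (M n) i z)
      (fun z => (Finset.sum_le_univ_sum_of_nonneg fun i => gridBump_nonneg u n (M n) i z).trans_eq
        (sum_gridBump hu01 n (M n) z))
      (hL n S) ha0 ha1
    refine h.trans ?_
    have h1 : C ‖y‖₊ ‖x‖₊ * ‖y - x‖ ^ α / a ≤ a := by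
      rw [div_le_iff₀ ha0, ← sq]
      exact hy1
    have h2 : δ (t n) * C' ‖y‖₊ ‖x‖₊ * ‖y - x‖ ^ β * L n ≤ K * (1 / ((n : ℝ) + 1)) := by
      calc δ (t n) * C' ‖y‖₊ ‖x‖₊ * ‖y - x‖ ^ β * L n
          = C' ‖y‖₊ ‖x‖₊ * ‖y - x‖ ^ β * (δ (t n) * L n) := by ring
        _ ≤ K * (1 / ((n : ℝ) + 1)) :=
          mul_le_mul hy2 (ht n) (mul_nonneg (hδ0 _) (hL0 n)) hK0.le
    linarith
  refine (transportDist_le_of_partition (truncatedPseudoMetric u n) _ _ (gridBump u n (M n))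
    (fun i => (differentiable_gridBump hu n (M n) i).continuous.measurable)
    (gridBump_nonneg u n (M n)) (sum_gridBump hu01 n (M n)) (fun z w => min_le_left _ _)
    _ _ hdiam hosc).trans ?_
  rw [← ENNReal.ofReal_add hn0.le (by positivity), ← ENNReal.ofReal_coe_nnreal]
  exact ENNReal.ofReal_le_ofReal (by linarith)
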